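/- Let $m\ge 1$ and $n\ge 3$ be integers. Let $W_n$ be the wheel with $n+1$ vertices and $2n$ edges (a hub joined to every vertex of a cycle $C_n$), and fix a vertex $r$ of $W_n$. Define graphs $G^{(i)}=G^{(i,m,n)}$, $i\ge 0$, by $G^{(0)}=W_n$, where $G^{(i+1)}$ is obtained from $G^{(i)}$ by replacing every edge with a path of length $m$ (adding $m-1$ new vertices per edge) and attaching to every vertex $v$ of $G^{(i)}$ (but not to the new vertices subdividing the edges) a new copy of $W_n$, by identifying the vertex $r$ of the copy with $v$. Put $|V^{(0)}|=1$ and let $|V^{(i+1)}|$ be the number of vertices of $G^{(i)}$ for $i\ge 0$. Let $L_k$ be the Lucas numbers, $L_1=1$, $L_2=3$, $L_{k+2}=L_{k+1}+L_k$. Then for every $i\ge 0$ the number of spanning trees of $G^{(i)}$ is $$\tau(G^{(i)})=(L_{2n}-2)^{\sum_{j=0}^{i}|V^{(j)}|}\; m^{\,n\sum_{j=0}^{i}(i-j)|V^{(j)}|}.$$ Moreover $|V^{(0)}|=1$, $|V^{(1)}|=n+1$, and for all $i\ge 2$ $$|V^{(i)}|=(n+m+1)\,|V^{(i-1)}|+(mn-m-2n)\,|V^{(i-2)}|.$$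 -/

import Mathlib

/-- The Lucas numbers: `L₀ = 2`, `L₁ = 1`, `L_{k+2} = L_{k+1} + L_k` (so `L₂ = 3`). -/
def lucas : ℕ → ℕ
  | 0 => 2
  | 1 => 1
  | k + 2 => lucas (k + 1) + lucas k

/-- The wheel `W_n`: the hub `none` joined to every vertex of the rim cycle `C_n` on `Fin n`. -/
def wheelGraph (n : ℕ) : SimpleGraph (Option (Fin n)) where
  Adj
    | none, none => False
    | none, some _ => True
    | some _, none => True
    | some a, some b => (SimpleGraph.cycleGraph n).Adj a b
  symm := ⟨by
    rintro (_ | a) (_ | b) h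
    · exact h
    · trivial
    · trivial
    · exact SimpleGraph.Adj.symm h⟩
  loopless := ⟨by
    rintro (_ | a) h
    · exact h
    · exact SimpleGraph.irrefl _ h⟩

/-- The number of spanning trees of a graph: the number of trees on the full vertex set all of
whose edges are edges of `G`. -/
noncomputable def spanningTreeCount {V : Type} (G : SimpleGraph V) : ℕ :=
  Nat.card {T : SimpleGraph V // T ≤ G ∧ T.IsTree}

/-- The vertices of the graph obtained from `G` by replacing each edge with a path of length `m`:
the old vertices, and `m - 1` new ones for each edge. -/
abbrev EdgePathVertex {V : Type} (G : SimpleGraph V) (m : ℕ) : Type :=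
  V ⊕ G.edgeSet × Fin (m - 1)

/-- The `k`-th point (`0 ≤ k ≤ m`) of the path of length `m` that replaces the edge `e`. The points
`0` and `m` are the two ends of `e`, in an arbitrarily chosen order; the points in between are the
`m - 1` new vertices that belong to `e`. -/
noncomputable def edgePathPoint {V : Type} (G : SimpleGraph V) (m : ℕ) (e : G.edgeSet) (k : ℕ) :
    EdgePathVertex G m :=
  if h0 : k = 0 then Sum.inl (Quot.out e.1).1
  else if hm : k < m then Sum.inr (e, ⟨k - 1, by omega⟩)
  else Sum.inl (Quot.out e.1).2

/-- Edge-path transformation: every edge of `G` is replaced with a path of length `m`. -/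
noncomputable def edgePathGraph {V : Type} (G : SimpleGraph V) (m : ℕ) :
    SimpleGraph (EdgePathVertex G m) :=
  SimpleGraph.fromEdgeSet
    {s | ∃ (e : G.edgeSet) (k : ℕ), k < m ∧ s = s(edgePathPoint G m e k, edgePathPoint G m e (k + 1))}

/-- The vertices of the graph obtained from a graph on `X` by attaching, for each `v : V`, a new
copy of a graph on `B` whose vertex `r` is identified with a vertex already present. -/
abbrev LinkVertex (X V : Type) {B : Type} (r : B) : Type :=
  X ⊕ V × {b : B // b ≠ r}

open Classical in
/-- The vertex `b` of the copy attached at `v`; the root `r` of this copy is the old vertex `f v`. -/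
noncomputable def linkPoint {X V B : Type} (f : V → X) (r : B) (v : V) (b : B) :
    LinkVertex X V r :=
  if h : b = r then Sum.inl (f v) else Sum.inr (v, ⟨b, h⟩)

/-- Graph-linking at vertices: to each vertex `f v` of `G` a new copy of the graph `K` is attached,
by identifying the vertex `r` of the copy with `f v`. -/
noncomputable def graphLink {X V B : Type} (G : SimpleGraph X) (f : V → X) (K : SimpleGraph B)
    (r : B) : SimpleGraph (LinkVertex X V r) :=
  SimpleGraph.fromEdgeSet
    (Sym2.map Sum.inl '' G.edgeSet ∪ ⋃ v : V, Sym2.map (linkPoint f r v) '' K.edgeSet)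

/-- A graph together with its vertex type. -/
structure BundledGraph where
  /-- The vertex type. -/
  Vertex : Type
  /-- The graph. -/
  graph : SimpleGraph Vertex

/-- The self-similar graph `G^{(i,m,n)}` based on `W_n`. It starts from `G^{(0,m,n)} = W_n`; then
`G^{(i+1,m,n)}` arises by replacing each edge of `G^{(i,m,n)}` with a path of length `m` and
attaching a new copy of `W_n`, by its vertex `r`, to each vertex of `G^{(i,m,n)}` (not to the
vertices that subdivide the edges). -/
noncomputable def wheelFractal (m n : ℕ) (r : Option (Fin n)) : ℕ → BundledGraph
  | 0 => ⟨Option (Fin n), wheelGraph n⟩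
  | i + 1 =>
    let G := (wheelFractal m n r i).graph
    ⟨_, graphLink (edgePathGraph G m) Sum.inl (wheelGraph n) r⟩

/-- The vertex counts `|V^{(j)}|`: `|V^{(0)}| = 1`, and `|V^{(i+1)}|` is the number of vertices of
`G^{(i,m,n)}`. -/
noncomputable def wheelFractalOrder (m n : ℕ) (r : Option (Fin n)) : ℕ → ℕ
  | 0 => 1
  | i + 1 => Nat.card (wheelFractal m n r i).Vertex

/-! A spanning tree of the wheel, rooted at the hub, is a choice of a parent for each rim vertex:
the hub, the next rim vertex or the previous one. Such a choice gives a tree exactly when the cyclic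
word of moves never has `next` followed by `prev` and is not one of the two constant words that run
around the rim. Words without the forbidden factor are counted by the trace of the `n`-th power of a
`3 × 3` matrix with characteristic polynomial `x (x² - 3 x + 1)`, which is `L_{2n}`; so
`τ(W_n) = L_{2n} - 2`.

Replacing the edges with paths of length `m` multiplies the number of spanning trees by `m ^ c`,
where `c` is the cyclomatic number: a spanning tree of the subdivided graph is one of the old graph
together with a missing part of each of the `c` edges outside it. Attaching copies of `K` at
vertices multiplies the number by one factor `τ(K)` per copy, since a spanning tree restricts to one
on each piece. The formula for `τ(G^{(i)})` follows by induction, and counting vertices and edges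
gives the recurrence for the orders. -/

section ParentFunctions

variable {α : Type*}

/-- The graph that joins every non-root vertex `a` to its parent `p a`; the root is `none`. -/
def parentGraph (p : α → Option α) : SimpleGraph (Option α) :=
  SimpleGraph.fromEdgeSet (Set.range fun a => s(some a, p a))

/-- Following the parent function from any vertex leads to the root `none` after finitely many
steps. -/
def IsRootedForest (p : α → Option α) : Prop :=
  WellFounded fun b a => p a = some b

theorem IsRootedForest.parent_ne_self {p : α → Option α} (hp : IsRootedForest p) (a : α) :
    some a ≠ p a :=
  fun h => hp.asymmetric _ _ h.symm h.symm

theorem IsRootedForest.parentGraph_adj {p : α → Option α} (hp : IsRootedForest p) (a : α) :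
    (parentGraph p).Adj (some a) (p a) :=
  (SimpleGraph.fromEdgeSet_adj _).2 ⟨⟨a, rfl⟩, hp.parent_ne_self a⟩

theorem parentGraph_le_iff {p : α → Option α} (hp : IsRootedForest p)
    {G : SimpleGraph (Option α)} : parentGraph p ≤ G ↔ ∀ a, G.Adj (some a) (p a) := by
  refine ⟨fun h a => h (hp.parentGraph_adj a), fun h => ?_⟩
  rw [parentGraph, SimpleGraph.fromEdgeSet_le]
  rintro _ ⟨⟨a, rfl⟩, -⟩
  exact h a

theorem IsRootedForest.isTree_parentGraph [Finite α] {p : α → Option α} (hp : IsRootedForest p) :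
    (parentGraph p).IsTree := by
  have hconn : (parentGraph p).Connected := by
    refine SimpleGraph.connected_iff_exists_forall_reachable _ |>.2 ⟨none, ?_⟩
    rintro (_ | a)
    · rfl
    · induction a using hp.induction with
      | _ a ih =>
        have hadj := (hp.parentGraph_adj a).symm.reachable
        rcases hpa : p a with _ | b
        · rwa [hpa] at hadj
        · exact (hpa ▸ ih b hpa).trans (hpa ▸ hadj)
  refine SimpleGraph.isTree_iff_connected_and_card.2
    ⟨hconn, le_antisymm ?_ hconn.card_vert_le_card_edgeSet_add_one⟩
  rw [Finite.card_option, parentGraph, SimpleGraph.edgeSet_fromEdgeSet, Nat.card_coe_set_eq]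
  exact Nat.succ_le_succ ((Set.ncard_le_ncard Set.sdiff_subset (Set.finite_range _)).trans
    (Finite.card_range_le _))

theorem IsRootedForest.eq_of_parentGraph_eq {p q : α → Option α} (hp : IsRootedForest p)
    (h : parentGraph p = parentGraph q) : p = q := by
  funext a
  induction a using hp.induction with
  | _ a ih =>
    have hadj : (parentGraph q).Adj (some a) (p a) := h ▸ hp.parentGraph_adj a
    obtain ⟨⟨b, hb⟩, -⟩ := (SimpleGraph.fromEdgeSet_adj _).1 hadj
    rcases Sym2.eq_iff.1 hb with ⟨hba, hqb⟩ | ⟨hbp, hqb⟩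
    · rw [← hqb, Option.some_injective _ hba]
    · exact (hp.asymmetric _ _ hbp.symm ((ih b hbp.symm).trans hqb)).elim

/-- In a tree every vertex has a neighbour closer to the root, which serves as its parent. -/
theorem exists_isRootedForest_parentGraph_eq [Finite α] {T : SimpleGraph (Option α)}
    (hT : T.IsTree) : ∃ p, IsRootedForest p ∧ parentGraph p = T := by
  have hcloser (a : α) : ∃ v, T.Adj (some a) v ∧ T.dist v none < T.dist (some a) none := by
    obtain ⟨w, hw⟩ := hT.connected.exists_walk_length_eq_dist (some a) none
    cases w with
    | cons hadj w => exact ⟨_, hadj, by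
        rw [← hw, SimpleGraph.Walk.length_cons]
        exact Nat.lt_succ_of_le (SimpleGraph.dist_le w)⟩
  choose p hadj hdist using hcloser
  have hp : IsRootedForest p :=
    Subrelation.wf (fun {b a} (h : p a = some b) => show T.dist (some b) none < _ from h ▸ hdist a)
      (InvImage.wf (fun a => T.dist (some a) none) wellFounded_lt)
  refine ⟨p, hp, ?_⟩
  exact (SimpleGraph.isTree_iff_minimal_connected.1 hT).eq_of_le
    hp.isTree_parentGraph.connected ((parentGraph_le_iff hp).2 hadj)

end ParentFunctions

theorem spanningTreeCount_eq_card_isRootedForest {α : Type} [Finite α]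
    (G : SimpleGraph (Option α)) :
    spanningTreeCount G =
      Nat.card {p : α → Option α // IsRootedForest p ∧ ∀ a, G.Adj (some a) (p a)} := by
  refine (Nat.card_eq_of_bijective (fun p : {p : α → Option α //
      IsRootedForest p ∧ ∀ a, G.Adj (some a) (p a)} =>
    (⟨parentGraph p.1, (parentGraph_le_iff p.2.1).2 p.2.2, p.2.1.isTree_parentGraph⟩ :
      {T : SimpleGraph (Option α) // T ≤ G ∧ T.IsTree})) ⟨fun p q h => ?_, ?_⟩).symm
  · exact Subtype.ext (p.2.1.eq_of_parentGraph_eq (Subtype.ext_iff.1 h))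
  · rintro ⟨T, hTG, hT⟩
    obtain ⟨p, hp, rfl⟩ := exists_isRootedForest_parentGraph_eq hT
    exact ⟨⟨p, hp, (parentGraph_le_iff hp).1 hTG⟩, rfl⟩

theorem forall_fin_of_forall_add_one {n : ℕ} [NeZero n] {P : Fin n → Prop} {j : Fin n} (hj : P j)
    (h : ∀ i, P i → P (i + 1)) (i : Fin n) : P i := by
  have hshift (k : ℕ) : P (j + Fin.ofNat n k) := by
    induction k with
    | zero => simpa using hj
    | succ k ih =>
      have hk : Fin.ofNat n k + 1 = Fin.ofNat n (k + 1) := by ext; simp [Fin.val_add]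
      rw [← hk, ← add_assoc]
      exact h _ ih
  simpa using hshift (i - j).val

theorem forall_fin_of_forall_sub_one {n : ℕ} [NeZero n] {P : Fin n → Prop} {j : Fin n} (hj : P j)
    (h : ∀ i, P i → P (i - 1)) (i : Fin n) : P i := by
  rw [← neg_neg i]
  refine forall_fin_of_forall_add_one (P := fun i => P (-i)) (j := -j) (by rwa [neg_neg]) ?_ (-i)
  intro i hi
  rw [neg_add']
  exact h _ hi

/-- The position of the parent of a rim vertex of a wheel rooted at its hub: the hub, the next rim
vertex or the previous one. -/
inductive RimMove
  | hub
  | next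
  | prev
  deriving DecidableEq

instance : Fintype RimMove := ⟨{.hub, .next, .prev}, by rintro (_ | _ | _) <;> decide⟩

/-- The parent function on the rim of the wheel that is described by a cyclic word of moves. -/
def rimParent {n : ℕ} [NeZero n] (w : Fin n → RimMove) (i : Fin n) : Option (Fin n) :=
  match w i with
  | .hub => none
  | .next => some (i + 1)
  | .prev => some (i - 1)

/-- No two consecutive rim vertices are each other's parents. -/
def NoBacktrack {n : ℕ} [NeZero n] (w : Fin n → RimMove) : Prop :=
  ∀ i, ¬(w i = .next ∧ w (i + 1) = .prev)

section RootedForestsOnWheels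

variable {n : ℕ} [NeZero n] {w : Fin n → RimMove}

theorem rimParent_of_hub {i : Fin n} (h : w i = .hub) : rimParent w i = none := by
  simp only [rimParent, h]

theorem rimParent_of_next {i : Fin n} (h : w i = .next) : rimParent w i = some (i + 1) := by
  simp only [rimParent, h]

theorem rimParent_of_prev {i : Fin n} (h : w i = .prev) : rimParent w i = some (i - 1) := by
  simp only [rimParent, h]

theorem noBacktrack_of_isRootedForest (h : IsRootedForest (rimParent w)) : NoBacktrack w := by
  rintro i ⟨hnext, hprev⟩
  refine h.asymmetric _ _ (rimParent_of_next hnext) ?_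
  rw [rimParent_of_prev hprev, add_sub_cancel_right]

theorem exists_ne_next_of_isRootedForest (h : IsRootedForest (rimParent w)) :
    ∃ i, w i ≠ .next := by
  by_contra! hall
  exact h.induction (C := fun _ => False) 0 fun i ih => ih (i + 1) (rimParent_of_next (hall i))

theorem exists_ne_prev_of_isRootedForest (h : IsRootedForest (rimParent w)) :
    ∃ i, w i ≠ .prev := by
  by_contra! hall
  exact h.induction (C := fun _ => False) 0 fun i ih => ih (i - 1) (rimParent_of_prev (hall i))

/-- From a rim vertex that never reaches the hub one would have to run around the rim forever, in
one direction since backtracking is excluded. -/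
theorem isRootedForest_rimParent (hw : NoBacktrack w) (hnext : ∃ i, w i ≠ .next)
    (hprev : ∃ i, w i ≠ .prev) : IsRootedForest (rimParent w) := by
  let Trapped (i : Fin n) : Prop := ¬Acc (fun b a => rimParent w a = some b) i
  have trapped_parent {i : Fin n} (hi : Trapped i) : ∃ j, rimParent w i = some j ∧ Trapped j := by
    by_contra! h
    exact hi ⟨i, fun j hj => not_not.1 (h j hj)⟩
  have ne_hub {i : Fin n} (hi : Trapped i) : w i ≠ .hub := fun h => by
    obtain ⟨j, hj, -⟩ := trapped_parent hi
    simp [rimParent_of_hub h] at hj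
  have next_step (i : Fin n) : Trapped i ∧ w i = .next → Trapped (i + 1) ∧ w (i + 1) = .next := by
    rintro ⟨hi, hwi⟩
    obtain ⟨j, hj, hjt⟩ := trapped_parent hi
    obtain rfl : i + 1 = j := Option.some_injective _ ((rimParent_of_next hwi).symm.trans hj)
    rcases h : w (i + 1)
    · exact (ne_hub hjt h).elim
    · exact ⟨hjt, rfl⟩
    · exact (hw i ⟨hwi, h⟩).elim
  have prev_step (i : Fin n) : Trapped i ∧ w i = .prev → Trapped (i - 1) ∧ w (i - 1) = .prev := by
    rintro ⟨hi, hwi⟩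
    obtain ⟨j, hj, hjt⟩ := trapped_parent hi
    obtain rfl : i - 1 = j := Option.some_injective _ ((rimParent_of_prev hwi).symm.trans hj)
    rcases h : w (i - 1)
    · exact (ne_hub hjt h).elim
    · exact (hw (i - 1) ⟨h, by rwa [sub_add_cancel]⟩).elim
    · exact ⟨hjt, rfl⟩
  refine ⟨fun i => ?_⟩
  by_contra hi
  rcases h : w i
  · exact ne_hub hi h
  · obtain ⟨k, hk⟩ := hnext
    exact hk (forall_fin_of_forall_add_one ⟨hi, h⟩ next_step k).2
  · obtain ⟨k, hk⟩ := hprev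
    exact hk (forall_fin_of_forall_sub_one ⟨hi, h⟩ prev_step k).2

theorem isRootedForest_rimParent_iff : IsRootedForest (rimParent w) ↔
    NoBacktrack w ∧ w ≠ (fun _ => .next) ∧ w ≠ fun _ => .prev := by
  simp only [Function.ne_iff]
  exact ⟨fun h => ⟨noBacktrack_of_isRootedForest h, exists_ne_next_of_isRootedForest h,
    exists_ne_prev_of_isRootedForest h⟩, fun h => isRootedForest_rimParent h.1 h.2.1 h.2.2⟩

end RootedForestsOnWheels

theorem wheelGraph_adj_some_some {k : ℕ} {i j : Fin (k + 2)} :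
    (wheelGraph (k + 2)).Adj (some i) (some j) ↔ j = i + 1 ∨ i = j + 1 := by
  change (SimpleGraph.cycleGraph (k + 2)).Adj i j ↔ _
  rw [SimpleGraph.cycleGraph_adj, sub_eq_iff_eq_add', sub_eq_iff_eq_add', or_comm]

theorem wheelGraph_adj_rimParent {k : ℕ} (w : Fin (k + 2) → RimMove) (i : Fin (k + 2)) :
    (wheelGraph (k + 2)).Adj (some i) (rimParent w i) := by
  rcases h : w i
  · rw [rimParent_of_hub h]
    trivial
  · rw [rimParent_of_next h, wheelGraph_adj_some_some]
    exact .inl rfl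
  · rw [rimParent_of_prev h, wheelGraph_adj_some_some]
    exact .inr (sub_add_cancel i 1).symm

theorem exists_rimParent_eq {k : ℕ} {p : Fin (k + 2) → Option (Fin (k + 2))}
    (hp : ∀ i, (wheelGraph (k + 2)).Adj (some i) (p i)) : ∃ w, rimParent w = p := by
  have hmove (i : Fin (k + 2)) : ∃ m : RimMove, rimParent (fun _ => m) i = p i := by
    have hadj := hp i
    rcases hpi : p i with _ | j
    · exact ⟨.hub, rfl⟩
    · rw [hpi, wheelGraph_adj_some_some] at hadj
      rcases hadj with rfl | rfl
      · exact ⟨.next, rfl⟩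
      · exact ⟨.prev, congrArg some (add_sub_cancel_right j 1)⟩
  choose w hw using hmove
  exact ⟨w, funext hw⟩

theorem fin_add_one_ne_sub_one {k : ℕ} (i : Fin (k + 3)) : i + 1 ≠ i - 1 := by
  rw [Ne, eq_sub_iff_add_eq, add_assoc, add_eq_left, Fin.ext_iff, Fin.val_add, Fin.val_one,
    Fin.val_zero, Nat.mod_eq_of_lt (by omega)]
  exact two_ne_zero

theorem rimParent_injective (k : ℕ) :
    Function.Injective
      (rimParent : (Fin (k + 3) → RimMove) → Fin (k + 3) → Option (Fin (k + 3))) := by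
  intro w w' h
  funext i
  have hne := fin_add_one_ne_sub_one i
  have hi := congrFun h i
  rcases hw : w i <;> rcases hw' : w' i <;> simp_all [rimParent, hne.symm]

section CyclicWords

variable {α R : Type*} [Fintype α] [DecidableEq α] [CommSemiring R]

theorem sum_prod_path_mul (M : Matrix α α R) (k : ℕ) (g : α → α → R) :
    ∑ c : Fin (k + 1) → α, (∏ i : Fin k, M (c i.castSucc) (c i.succ)) * g (c 0) (c (Fin.last k)) =
      ∑ x, ∑ y, (M ^ k) x y * g x y := by
  induction k generalizing g with
  | zero =>
    rw [← (Equiv.funUnique (Fin 1) α).symm.sum_comp]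
    simp [Matrix.one_apply]
  | succ k ih =>
    rw [← (Fin.consEquiv fun _ => α).sum_comp, Fintype.sum_prod_type]
    refine Finset.sum_congr rfl fun x _ => ?_
    simp only [Fin.consEquiv, Equiv.coe_fn_mk, Fin.prod_univ_succ, Fin.castSucc_zero,
      Fin.cons_zero, Fin.cons_succ, ← Fin.succ_last, ← Fin.succ_castSucc]
    calc ∑ c : Fin (k + 1) → α, M x (c 0) * (∏ i : Fin k, M (c i.castSucc) (c i.succ)) *
            g x (c (Fin.last k))
        = ∑ c : Fin (k + 1) → α, (∏ i : Fin k, M (c i.castSucc) (c i.succ)) *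
            (M x (c 0) * g x (c (Fin.last k))) :=
          Finset.sum_congr rfl fun c _ => by ring
      _ = ∑ z, ∑ y, (M ^ k) z y * (M x z * g x y) := ih fun z y => M x z * g x y
      _ = ∑ y, ∑ z, M x z * (M ^ k) z y * g x y := by
          rw [Finset.sum_comm]
          exact Finset.sum_congr rfl fun y _ => Finset.sum_congr rfl fun z _ => by ring
      _ = ∑ y, (M ^ (k + 1)) x y * g x y := by
          simp only [pow_succ', Matrix.mul_apply, Finset.sum_mul]

theorem sum_prod_cycle_eq_trace_pow (M : Matrix α α R) (n : ℕ) [NeZero n] :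
    ∑ c : Fin n → α, ∏ i : Fin n, M (c i) (c (i + 1)) = (M ^ n).trace := by
  obtain ⟨k, rfl⟩ := Nat.exists_eq_succ_of_ne_zero (NeZero.ne n)
  simp only [Nat.succ_eq_add_one, Fin.prod_univ_castSucc, Fin.coeSucc_eq_succ, Fin.last_add_one]
  rw [sum_prod_path_mul M k fun x y => M y x, pow_succ]
  simp only [Matrix.trace, Matrix.diag_apply, Matrix.mul_apply]

theorem card_cyclicWord_eq_trace_pow (r : α → α → Prop) [DecidableRel r] (n : ℕ) [NeZero n] :
    Nat.card {w : Fin n → α // ∀ i, r (w i) (w (i + 1))} =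
      ((Matrix.of fun x y => if r x y then 1 else 0) ^ n : Matrix α α ℕ).trace := by
  rw [← sum_prod_cycle_eq_trace_pow, Nat.card_eq_fintype_card, Fintype.card_subtype]
  simp only [Matrix.of_apply, Fintype.prod_ite_zero, Finset.prod_const_one, Finset.sum_boole,
    Nat.cast_id]

end CyclicWords

theorem lucas_two_mul_recurrence (k : ℕ) :
    lucas (2 * (k + 2)) + lucas (2 * k) = 3 * lucas (2 * (k + 1)) := by
  simp only [mul_add, Nat.reduceMul, lucas]
  ring

/-- The transfer matrix of the words without backtracking: its entry at `x`, `y` is `1` if the move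
`y` may follow the move `x`, and `0` otherwise. -/
def rimTransfer : Matrix RimMove RimMove ℕ :=
  Matrix.of fun x y => if ¬(x = .next ∧ y = .prev) then 1 else 0

theorem trace_rimTransfer_pow_recurrence (k : ℕ) :
    (rimTransfer ^ (k + 3)).trace + (rimTransfer ^ (k + 1)).trace =
      3 * (rimTransfer ^ (k + 2)).trace := by
  have hcharpoly : rimTransfer ^ 3 + rimTransfer = 3 • rimTransfer ^ 2 := by
    simp only [pow_succ, pow_zero, one_mul]
    ext x y
    rcases x <;> rcases y <;> decide
  have h := congrArg (fun M => (rimTransfer ^ k * M).trace) hcharpoly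
  simpa only [mul_add, mul_smul_comm, ← pow_add, ← pow_succ, Matrix.trace_add, Matrix.trace_smul,
    smul_eq_mul] using h

theorem trace_rimTransfer_pow (k : ℕ) : (rimTransfer ^ (k + 1)).trace = lucas (2 * (k + 1)) := by
  induction k using Nat.twoStepInduction with
  | zero => simp only [zero_add, pow_one]; decide
  | one => simp only [pow_succ, pow_zero, one_mul]; decide
  | more k ih₀ ih₁ =>
    have htrace : (rimTransfer ^ (k + 2 + 1)).trace + (rimTransfer ^ (k + 1)).trace =
        3 * (rimTransfer ^ (k + 1 + 1)).trace := trace_rimTransfer_pow_recurrence k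
    have hlucas : lucas (2 * (k + 2 + 1)) + lucas (2 * (k + 1)) =
        3 * lucas (2 * (k + 1 + 1)) := lucas_two_mul_recurrence (k + 1)
    rw [ih₀, ih₁] at htrace
    omega

theorem card_noBacktrack (n : ℕ) [NeZero n] :
    Nat.card {w : Fin n → RimMove // NoBacktrack w} = lucas (2 * n) := by
  obtain ⟨k, rfl⟩ := Nat.exists_eq_succ_of_ne_zero (NeZero.ne n)
  exact (card_cyclicWord_eq_trace_pow (fun x y : RimMove => ¬(x = .next ∧ y = .prev)) (k + 1)).trans
    (trace_rimTransfer_pow k)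

theorem card_isRootedForest_rimParent (n : ℕ) [NeZero n] :
    Nat.card {w : Fin n → RimMove // IsRootedForest (rimParent w)} + 2 = lucas (2 * n) := by
  let constWords : Set (Fin n → RimMove) := {fun _ => .next, fun _ => .prev}
  have hforest : {w : Fin n → RimMove | IsRootedForest (rimParent w)} =
      {w | NoBacktrack w} \ constWords := by
    ext w
    simp only [constWords, Set.mem_sdiff, Set.mem_ofPred_eq, Set.mem_insert_iff,
      Set.mem_singleton_iff, not_or, isRootedForest_rimParent_iff]
  have hconst : constWords ⊆ {w | NoBacktrack w} := by
    rintro w (rfl | rfl) i <;> simp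
  have hpair : constWords.ncard = 2 :=
    Set.ncard_pair fun h => by simpa using congrFun h 0
  rw [← card_noBacktrack, ← Set.coe_ofPred, ← Set.coe_ofPred, Nat.card_coe_set_eq,
    Nat.card_coe_set_eq, hforest, ← hpair, Set.ncard_sdiff_add_ncard_of_subset hconst]

theorem spanningTreeCount_wheelGraph {n : ℕ} (hn : 3 ≤ n) :
    spanningTreeCount (wheelGraph n) + 2 = lucas (2 * n) := by
  obtain ⟨k, rfl⟩ := Nat.exists_eq_add_of_le' hn
  rw [spanningTreeCount_eq_card_isRootedForest, ← card_isRootedForest_rimParent]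
  congr 1
  refine (Nat.card_eq_of_bijective (fun w : {w : Fin (k + 3) → RimMove //
    IsRootedForest (rimParent w)} => ⟨rimParent w.1, w.2, wheelGraph_adj_rimParent w.1⟩)
    ⟨fun w w' h => ?_, ?_⟩).symm
  · exact Subtype.ext (rimParent_injective k (Subtype.ext_iff.1 h))
  · rintro ⟨p, hp, hadj⟩
    obtain ⟨w, rfl⟩ := exists_rimParent_eq hadj
    exact ⟨⟨w, hp⟩, rfl⟩

section EdgeFamilies

variable {V W E : Type*} {a b : E → V} {S : Set E}

/-- The graph formed by the edges in `S`, where the ends of the edge `e` are `a e` and `b e`. -/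
def edgeGraph (a b : E → V) (S : Set E) : SimpleGraph V :=
  SimpleGraph.fromEdgeSet ((fun e => s(a e, b e)) '' S)

/-- The set `S` of edges is a spanning tree of the graph with edge ends `a` and `b`: it connects
all vertices and has the number of edges of a tree. -/
def IsSpanningTreeSet (a b : E → V) (S : Set E) : Prop :=
  (edgeGraph a b S).Connected ∧ S.ncard + 1 = Nat.card V

/-- The number of spanning trees, as edge sets, of the graph with edge ends `a` and `b`. -/
noncomputable def treeSetCount (a b : E → V) : ℕ :=
  Nat.card {S : Set E // IsSpanningTreeSet a b S}

theorem reachable_edgeGraph {e : E} (he : e ∈ S) : (edgeGraph a b S).Reachable (a e) (b e) := by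
  by_cases hab : a e = b e
  · rw [hab]
  · exact ((SimpleGraph.fromEdgeSet_adj _).2 ⟨⟨e, he, rfl⟩, hab⟩ :
      (edgeGraph a b S).Adj (a e) (b e)).reachable

theorem reachable_map_of_edgeGraph {H : SimpleGraph W} (f : V → W)
    (h : ∀ e ∈ S, H.Reachable (f (a e)) (f (b e))) {u v : V}
    (huv : (edgeGraph a b S).Reachable u v) : H.Reachable (f u) (f v) := by
  simp only [SimpleGraph.reachable_iff_reflTransGen _ _] at huv
  induction huv with
  | refl => rfl
  | tail _ hadj ih =>
    obtain ⟨⟨e, he, hends⟩, -⟩ := (SimpleGraph.fromEdgeSet_adj _).1 hadj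
    rcases Sym2.eq_iff.1 hends with ⟨rfl, rfl⟩ | ⟨rfl, rfl⟩
    · exact ih.trans (h e he)
    · exact ih.trans (h e he).symm

theorem eq_of_reachable_edgeGraph (f : V → W) (h : ∀ e ∈ S, f (a e) = f (b e)) {u v : V}
    (huv : (edgeGraph a b S).Reachable u v) : f u = f v := by
  simp only [← SimpleGraph.reachable_bot] at h ⊢
  exact reachable_map_of_edgeGraph f h huv

theorem card_le_of_connected_edgeGraph [Finite E] (h : (edgeGraph a b S).Connected) :
    Nat.card V ≤ S.ncard + 1 := by
  refine h.card_vert_le_card_edgeSet_add_one.trans (Nat.add_le_add_right ?_ 1)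
  rw [edgeGraph, SimpleGraph.edgeSet_fromEdgeSet, Nat.card_coe_set_eq]
  exact (Set.ncard_le_ncard Set.sdiff_subset (S.toFinite.image _)).trans
    (Set.ncard_image_le S.toFinite)

/-- The edges of `G` are, without repetition, the pairs `s(a e, b e)`. -/
structure IsEdgeListing (G : SimpleGraph V) (a b : E → V) : Prop where
  injective : Function.Injective fun e => s(a e, b e)
  range_eq : Set.range (fun e => s(a e, b e)) = G.edgeSet

variable {G : SimpleGraph V}

theorem IsEdgeListing.ne (h : IsEdgeListing G a b) (e : E) : a e ≠ b e :=
  SimpleGraph.Adj.ne (G := G) (h.range_eq ▸ ⟨e, rfl⟩ : s(a e, b e) ∈ G.edgeSet)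

theorem IsEdgeListing.card_edgeSet (h : IsEdgeListing G a b) :
    Nat.card G.edgeSet = Nat.card E := by
  rw [← h.range_eq]
  exact Nat.card_range_of_injective h.injective

theorem IsEdgeListing.edgeSet_edgeGraph (h : IsEdgeListing G a b) (S : Set E) :
    (edgeGraph a b S).edgeSet = (fun e => s(a e, b e)) '' S := by
  rw [edgeGraph, SimpleGraph.edgeSet_fromEdgeSet, sdiff_eq_left, Set.disjoint_left]
  rintro _ ⟨e, -, rfl⟩ hdiag
  exact h.ne e (by simpa using hdiag)

theorem isEdgeListing_of_eq_edgeGraph_univ (hG : G = edgeGraph a b Set.univ)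
    (hinj : Function.Injective fun e => s(a e, b e)) (hne : ∀ e, a e ≠ b e) :
    IsEdgeListing G a b := by
  refine ⟨hinj, ?_⟩
  rw [hG, edgeGraph, SimpleGraph.edgeSet_fromEdgeSet, Set.image_univ, eq_comm, sdiff_eq_left,
    Set.disjoint_left]
  rintro _ ⟨e, rfl⟩ hdiag
  exact hne e (by simpa using hdiag)

theorem IsEdgeListing.isSpanningTreeSet_iff [Finite V] (h : IsEdgeListing G a b) (S : Set E) :
    IsSpanningTreeSet a b S ↔ (edgeGraph a b S).IsTree := by
  rw [SimpleGraph.isTree_iff_connected_and_card, h.edgeSet_edgeGraph, Nat.card_coe_set_eq,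
    Set.ncard_image_of_injective S h.injective, IsSpanningTreeSet]

end EdgeFamilies

theorem spanningTreeCount_eq_treeSetCount {V : Type} {E : Type*} [Finite V] {G : SimpleGraph V}
    {a b : E → V} (h : IsEdgeListing G a b) : spanningTreeCount G = treeSetCount a b := by
  have hle (S : Set E) : edgeGraph a b S ≤ G := by
    rw [← SimpleGraph.edgeSet_subset_edgeSet, h.edgeSet_edgeGraph, ← h.range_eq]
    exact Set.image_subset_range _ _
  refine (Nat.card_eq_of_bijective (fun S : {S : Set E // IsSpanningTreeSet a b S} =>
    (⟨edgeGraph a b S.1, hle S.1, (h.isSpanningTreeSet_iff S.1).1 S.2⟩ :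
      {T : SimpleGraph V // T ≤ G ∧ T.IsTree})) ⟨fun S S' hS => ?_, ?_⟩).symm
  · have hedges := congrArg SimpleGraph.edgeSet (Subtype.ext_iff.1 hS)
    rw [h.edgeSet_edgeGraph, h.edgeSet_edgeGraph] at hedges
    exact Subtype.ext (h.injective.image_injective hedges)
  · rintro ⟨T, hTG, hT⟩
    obtain ⟨S, hS⟩ := Set.subset_range_iff_exists_image_eq.1
      ((SimpleGraph.edgeSet_subset_edgeSet.2 hTG).trans_eq h.range_eq.symm)
    obtain rfl : edgeGraph a b S = T := by
      rw [edgeGraph, hS, SimpleGraph.fromEdgeSet_edgeSet]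
    exact ⟨⟨S, (h.isSpanningTreeSet_iff S).2 hT⟩, rfl⟩

section Subdivision

variable {V : Type} (G : SimpleGraph V)

/-- The end of `e` at which the path that replaces `e` starts. -/
noncomputable def edgeStart (e : G.edgeSet) : V := (Quot.out e.1).1

/-- The end of `e` at which the path that replaces `e` stops. -/
noncomputable def edgeStop (e : G.edgeSet) : V := (Quot.out e.1).2

/-- The start of a part of an edge: the `k`-th part of `e` is the `k`-th edge of the path that
replaces `e`. -/
noncomputable def partStart (m : ℕ) (x : G.edgeSet × Fin m) : EdgePathVertex G m :=
  edgePathPoint G m x.1 x.2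

/-- The end of a part of an edge. -/
noncomputable def partStop (m : ℕ) (x : G.edgeSet × Fin m) : EdgePathVertex G m :=
  edgePathPoint G m x.1 (x.2 + 1)

theorem isEdgeListing_edgeStart_edgeStop : IsEdgeListing G (edgeStart G) (edgeStop G) := by
  have hends (e : G.edgeSet) : s(edgeStart G e, edgeStop G e) = e.1 := Quot.out_eq e.1
  refine ⟨fun e e' h => Subtype.ext ((hends e).symm.trans (h.trans (hends e'))), ?_⟩
  simp only [hends, Subtype.range_coe]

theorem edgePathPoint_zero (m : ℕ) (e : G.edgeSet) :
    edgePathPoint G m e 0 = Sum.inl (edgeStart G e) :=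
  rfl

theorem edgePathPoint_self {m : ℕ} (hm : 1 ≤ m) (e : G.edgeSet) :
    edgePathPoint G m e m = Sum.inl (edgeStop G e) := by
  rw [edgePathPoint, dif_neg (by omega), dif_neg (lt_irrefl m), edgeStop]

theorem edgePathPoint_add_one {m : ℕ} (e : G.edgeSet) (j : Fin (m - 1)) :
    edgePathPoint G m e (j + 1) = Sum.inr (e, j) := by
  rw [edgePathPoint, dif_neg (Nat.succ_ne_zero _), dif_pos (by omega)]
  rfl

theorem isEdgeListing_edgePathGraph (m : ℕ) :
    IsEdgeListing (edgePathGraph G m) (partStart G m) (partStop G m) := by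
  have hG := isEdgeListing_edgeStart_edgeStop G
  refine isEdgeListing_of_eq_edgeGraph_univ ?_ ?_ ?_
  · rw [edgePathGraph, edgeGraph]
    congr 1
    ext s
    constructor
    · rintro ⟨e, k, hk, rfl⟩
      exact ⟨(e, ⟨k, hk⟩), trivial, rfl⟩
    · rintro ⟨⟨e, k⟩, -, rfl⟩
      exact ⟨e, k, k.2, rfl⟩
  · rintro ⟨e, k, hk⟩ ⟨e', l, hl⟩ h
    have hne := hG.ne e
    have hinj := @hG.injective e e'
    simp only [edgeStart, edgeStop, partStart, partStop, edgePathPoint, Sym2.eq_iff]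
      at h hne hinj
    suffices e = e' ∧ k = l by simpa
    split_ifs at h <;> grind
  · rintro ⟨e, k, hk⟩ h
    have hne := hG.ne e
    simp only [edgeStart, edgeStop, partStart, partStop, edgePathPoint] at h hne
    split_ifs at h <;> grind

/-- The edges all of whose parts belong to `S`. -/
def fullEdges {E : Type*} {m : ℕ} (S : Set (E × Fin m)) : Set E := {e | ∀ k, (e, k) ∈ S}

variable {G} {m : ℕ} {S : Set (G.edgeSet × Fin m)}

/-- The points strictly between two missing parts of the same edge would be cut off. -/
theorem injOn_compl_of_connected_parts
    (h : (edgeGraph (partStart G m) (partStop G m) S).Connected) : Set.InjOn Prod.fst Sᶜ := by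
  have hcut (e : G.edgeSet) (k l : Fin m) (hk : (e, k) ∉ S) (hl : (e, l) ∉ S) (hkl : k < l) :
      False := by
    let between : EdgePathVertex G m → Prop :=
      Sum.elim (fun _ => False) fun x => x.1 = e ∧ (k : ℕ) ≤ x.2 ∧ (x.2 : ℕ) < l
    have between_point (e' : G.edgeSet) (j : ℕ) :
        between (edgePathPoint G m e' j) = (e' = e ∧ k < j ∧ j ≤ l) := by
      unfold edgePathPoint
      split_ifs <;> simp only [between, Sum.elim_inl, Sum.elim_inr] <;> grind
    have hconst (x) (hx : x ∈ S) :
        between (partStart G m x) = between (partStop G m x) := by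
      have hxk : ¬(x.1 = e ∧ x.2 = k) := by rintro ⟨rfl, rfl⟩; exact hk hx
      have hxl : ¬(x.1 = e ∧ x.2 = l) := by rintro ⟨rfl, rfl⟩; exact hl hx
      rw [partStart, partStop, between_point, between_point]
      grind
    have hends := eq_of_reachable_edgeGraph between hconst
      (h.preconnected (edgePathPoint G m e k) (edgePathPoint G m e (k + 1)))
    rw [between_point, between_point] at hends
    grind
  rintro ⟨e, k⟩ hk ⟨e', l⟩ hl (rfl : e = e')
  rcases lt_trichotomy k l with hkl | rfl | hkl
  · exact (hcut e k l hk hl hkl).elim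
  · rfl
  · exact (hcut e l k hl hk hkl).elim

open Classical in
/-- Contract each path to the two ends of its edge: the `j`-th point goes to the start if no part
before it is missing. -/
theorem connected_fullEdges_of_connected_parts
    (h : (edgeGraph (partStart G m) (partStop G m) S).Connected) :
    (edgeGraph (edgeStart G) (edgeStop G) (fullEdges S)).Connected := by
  let H := edgeGraph (edgeStart G) (edgeStop G) (fullEdges S)
  let side (e : G.edgeSet) (j : ℕ) : V :=
    if ∀ k : Fin m, (k : ℕ) < j → (e, k) ∈ S then edgeStart G e else edgeStop G e
  let contract : EdgePathVertex G m → V := Sum.elim id fun x => side x.1 (x.2 + 1)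
  have contract_point (e : G.edgeSet) (j : ℕ) :
      H.Reachable (contract (edgePathPoint G m e j)) (side e j) := by
    unfold edgePathPoint
    split_ifs with h0 hj
    · simp [contract, side, h0, edgeStart]
    · simp only [contract, Sum.elim_inr, Nat.sub_add_cancel (Nat.one_le_iff_ne_zero.2 h0)]
      rfl
    · simp only [contract, side, Sum.elim_inl]
      split_ifs with hfull
      · have he : e ∈ fullEdges S := fun k => hfull k (by omega)
        exact (reachable_edgeGraph he).symm
      · rfl
  have side_eq (x) (hx : x ∈ S) : side x.1 x.2 = side x.1 (x.2 + 1) := by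
    simp only [side]
    congr 1
    grind
  have : Nonempty V := h.nonempty.map contract
  exact ⟨fun u v => reachable_map_of_edgeGraph contract (fun x hx =>
    ((side_eq x hx) ▸ contract_point x.1 x.2).trans (contract_point x.1 (x.2 + 1)).symm)
    (h.preconnected (Sum.inl u) (Sum.inl v))⟩

theorem reachable_edgePathPoint {e : G.edgeSet} {i j : ℕ} (hij : i ≤ j) (hj : j ≤ m)
    (hS : ∀ k : Fin m, i ≤ k → k < j → (e, k) ∈ S) :
    (edgeGraph (partStart G m) (partStop G m) S).Reachable
      (edgePathPoint G m e i) (edgePathPoint G m e j) := by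
  induction j, hij using Nat.le_induction with
  | base => rfl
  | succ j hij ih =>
    refine (ih (by omega) fun k hik hkj => hS k hik (by omega)).trans ?_
    exact reachable_edgeGraph (hS ⟨j, hj⟩ hij (Nat.lt_succ_self j))

theorem connected_parts_of_connected_fullEdges (hm : 1 ≤ m) (hS : Set.InjOn Prod.fst Sᶜ)
    (h : (edgeGraph (edgeStart G) (edgeStop G) (fullEdges S)).Connected) :
    (edgeGraph (partStart G m) (partStop G m) S).Connected := by
  let H := edgeGraph (partStart G m) (partStop G m) S
  have hold (u v : V) : H.Reachable (Sum.inl u) (Sum.inl v) := by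
    refine reachable_map_of_edgeGraph Sum.inl (fun e he => ?_) (h.preconnected u v)
    rw [← edgePathPoint_zero G m, ← edgePathPoint_self G hm]
    exact reachable_edgePathPoint (Nat.zero_le m) le_rfl fun k _ _ => he k
  have hnew (e : G.edgeSet) (j : Fin (m - 1)) :
      H.Reachable (Sum.inl (edgeStart G e)) (Sum.inr (e, j)) := by
    rw [← edgePathPoint_add_one G]
    by_cases hbefore : ∀ k : Fin m, (k : ℕ) < j + 1 → (e, k) ∈ S
    · rw [← edgePathPoint_zero G m]
      exact reachable_edgePathPoint (Nat.zero_le _) (by omega) fun k _ => hbefore k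
    · push Not at hbefore
      obtain ⟨k, hkj, hk⟩ := hbefore
      refine (hold _ (edgeStop G e)).trans ?_
      rw [← edgePathPoint_self G hm]
      refine (reachable_edgePathPoint (by omega) le_rfl fun l hjl _ => ?_).symm
      by_contra hl
      obtain rfl : l = k := congrArg Prod.snd (hS hl hk rfl)
      omega
  obtain ⟨v⟩ := h.nonempty
  refine (SimpleGraph.connected_iff_exists_forall_reachable _).2 ⟨Sum.inl v, ?_⟩
  rintro (u | ⟨e, j⟩)
  · exact hold v u
  · exact (hold v _).trans (hnew e j)

theorem ncard_add_ncard_compl_fullEdges {E : Type*} [Finite E] {S : Set (E × Fin m)}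
    (hS : Set.InjOn Prod.fst Sᶜ) : S.ncard + (fullEdges S)ᶜ.ncard = Nat.card E * m := by
  have himage : Prod.fst '' Sᶜ = (fullEdges S)ᶜ := by
    ext e
    simp [fullEdges]
  rw [← himage, hS.ncard_image, Set.ncard_add_ncard_compl, Nat.card_prod, Nat.card_fin]

theorem isSpanningTreeSet_parts_iff [Finite V] (hm : 1 ≤ m) :
    IsSpanningTreeSet (partStart G m) (partStop G m) S ↔
      Set.InjOn Prod.fst Sᶜ ∧ IsSpanningTreeSet (edgeStart G) (edgeStop G) (fullEdges S) := by
  have hconn : (edgeGraph (partStart G m) (partStop G m) S).Connected ↔ Set.InjOn Prod.fst Sᶜ ∧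
      (edgeGraph (edgeStart G) (edgeStop G) (fullEdges S)).Connected :=
    ⟨fun h => ⟨injOn_compl_of_connected_parts h, connected_fullEdges_of_connected_parts h⟩,
      fun h => connected_parts_of_connected_fullEdges hm h.1 h.2⟩
  rw [IsSpanningTreeSet, hconn, and_assoc]
  refine and_congr_right fun hS => and_congr_right fun _ => ?_
  have hparts := ncard_add_ncard_compl_fullEdges hS
  have hedges := Set.ncard_add_ncard_compl (fullEdges S)
  have hvertices : Nat.card (EdgePathVertex G m) = Nat.card V + Nat.card G.edgeSet * (m - 1) := by
    rw [Nat.card_sum, Nat.card_prod, Nat.card_fin]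
  obtain ⟨m, rfl⟩ := Nat.exists_eq_add_of_le' hm
  rw [Nat.mul_succ] at hparts
  rw [Nat.add_sub_cancel] at hvertices
  omega

end Subdivision

section OmittedParts

variable {E : Type*} {m : ℕ}

/-- All parts of all edges, except that each edge `e` outside `T` misses its part `g e`. -/
def omitParts (T : Set E) (g : ↥Tᶜ → Fin m) : Set (E × Fin m) :=
  {x | ∀ h : x.1 ∉ T, g ⟨x.1, h⟩ ≠ x.2}

theorem notMem_omitParts {T : Set E} {g : ↥Tᶜ → Fin m} {e : E} {k : Fin m} :
    (e, k) ∉ omitParts T g ↔ ∃ h : e ∉ T, g ⟨e, h⟩ = k := by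
  simp only [omitParts, Set.mem_ofPred_eq, not_forall, not_not]

theorem injOn_compl_omitParts (T : Set E) (g : ↥Tᶜ → Fin m) :
    Set.InjOn Prod.fst (omitParts T g)ᶜ := by
  rintro ⟨e, k⟩ hk ⟨e', l⟩ hl (rfl : e = e')
  obtain ⟨_, rfl⟩ := notMem_omitParts.1 hk
  obtain ⟨_, rfl⟩ := notMem_omitParts.1 hl
  rfl

theorem fullEdges_omitParts (T : Set E) (g : ↥Tᶜ → Fin m) : fullEdges (omitParts T g) = T := by
  ext e
  rw [← not_iff_not]
  simp only [fullEdges, Set.mem_ofPred_eq, not_forall, notMem_omitParts]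
  exact ⟨fun ⟨_, h, _⟩ => h, fun h => ⟨_, h, rfl⟩⟩

theorem omitParts_injective (T : Set E) :
    Function.Injective (omitParts T : (↥Tᶜ → Fin m) → Set (E × Fin m)) := by
  intro g g' h
  ext1 ⟨e, he⟩
  have hmem : (e, g ⟨e, he⟩) ∉ omitParts T g' := h ▸ notMem_omitParts.2 ⟨he, rfl⟩
  exact (notMem_omitParts.1 hmem).2.symm

theorem exists_omitParts_eq {S : Set (E × Fin m)} (hS : Set.InjOn Prod.fst Sᶜ) :
    ∃ g : ↥(fullEdges S)ᶜ → Fin m, omitParts (fullEdges S) g = S := by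
  have hmissing (e : ↥(fullEdges S)ᶜ) : ∃ k, (e.1, k) ∉ S := not_forall.1 e.2
  choose g hg using hmissing
  refine ⟨g, Set.ext fun ⟨e, k⟩ => ?_⟩
  rw [← not_iff_not, notMem_omitParts]
  refine ⟨?_, fun hk => ?_⟩
  · rintro ⟨he, rfl⟩
    exact hg ⟨e, he⟩
  · have he : e ∉ fullEdges S := fun he => hk (he k)
    exact ⟨he, congrArg Prod.snd (hS (hg ⟨e, he⟩) hk rfl)⟩

theorem bijective_omitParts (P : Set E → Prop) :
    Function.Bijective
      (fun x : (T : {T : Set E // P T}) × (↥T.1ᶜ → Fin m) =>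
        (⟨omitParts x.1.1 x.2, injOn_compl_omitParts _ _,
          (fullEdges_omitParts _ x.2).symm ▸ x.1.2⟩ :
        {S : Set (E × Fin m) // Set.InjOn Prod.fst Sᶜ ∧ P (fullEdges S)})) := by
  constructor
  · rintro ⟨⟨T, hT⟩, g⟩ ⟨⟨T', hT'⟩, g'⟩ h
    have h : omitParts T g = omitParts T' g' := Subtype.ext_iff.1 h
    obtain rfl : T = T' := by rw [← fullEdges_omitParts T g, h, fullEdges_omitParts]
    rw [omitParts_injective T h]
  · rintro ⟨S, hS, hP⟩
    obtain ⟨g, hg⟩ := exists_omitParts_eq hS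
    exact ⟨⟨⟨fullEdges S, hP⟩, g⟩, Subtype.ext hg⟩

end OmittedParts

theorem spanningTreeCount_edgePathGraph {V : Type} [Finite V] (G : SimpleGraph V) {m c : ℕ}
    (hm : 1 ≤ m) (hc : c + Nat.card V = Nat.card G.edgeSet + 1) :
    spanningTreeCount (edgePathGraph G m) = spanningTreeCount G * m ^ c := by
  rw [spanningTreeCount_eq_treeSetCount (isEdgeListing_edgeStart_edgeStop G),
    spanningTreeCount_eq_treeSetCount (isEdgeListing_edgePathGraph G m), treeSetCount, treeSetCount]
  simp only [isSpanningTreeSet_parts_iff hm]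
  rw [← Nat.card_eq_of_bijective _
    (bijective_omitParts (IsSpanningTreeSet (edgeStart G) (edgeStop G)))]
  have := Fintype.ofFinite {T // IsSpanningTreeSet (edgeStart G) (edgeStop G) T}
  have hfiber (T : {T // IsSpanningTreeSet (edgeStart G) (edgeStop G) T}) :
      Nat.card (↥T.1ᶜ → Fin m) = m ^ c := by
    have hedges := Set.ncard_add_ncard_compl T.1
    have htree := T.2.2
    rw [Nat.card_fun, Nat.card_fin, Nat.card_coe_set_eq, show T.1ᶜ.ncard = c by omega]
  rw [Nat.card_sigma, Finset.sum_congr rfl fun T _ => hfiber T, Finset.sum_const,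
    Finset.card_univ, smul_eq_mul, Nat.card_eq_fintype_card]

theorem card_edgeSet_edgePathGraph {V : Type} (G : SimpleGraph V) (m : ℕ) :
    Nat.card (edgePathGraph G m).edgeSet = Nat.card G.edgeSet * m := by
  rw [(isEdgeListing_edgePathGraph G m).card_edgeSet, Nat.card_prod, Nat.card_fin]

section Linking

variable {X V B : Type} (φ : V → X) (r : B)

theorem linkPoint_root (v : V) : linkPoint φ r v r = Sum.inl (φ v) :=
  dif_pos rfl

theorem linkPoint_of_ne (v : V) {x : B} (hx : x ≠ r) :
    linkPoint φ r v x = Sum.inr (v, ⟨x, hx⟩) :=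
  dif_neg hx

theorem linkPoint_injective (v : V) : Function.Injective (linkPoint φ r v) := by
  intro x y h
  unfold linkPoint at h
  split_ifs at h <;> grind

variable {φ r}

theorem sym2_inl_ne_sym2_linkPoint {v : V} {x y : B} (hxy : x ≠ y) (u w : X) :
    s(Sum.inl u, Sum.inl w) ≠ s(linkPoint φ r v x, linkPoint φ r v y) := by
  intro h
  rw [Sym2.eq_iff] at h
  unfold linkPoint at h
  split_ifs at h <;> grind

theorem eq_of_sym2_linkPoint_eq {v v' : V} {x y x' y' : B} (hxy : x ≠ y)
    (h : s(linkPoint φ r v x, linkPoint φ r v y) = s(linkPoint φ r v' x', linkPoint φ r v' y')) :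
    v = v' := by
  rw [Sym2.eq_iff] at h
  unfold linkPoint at h
  split_ifs at h <;> grind

variable {E F : Type*} {a b : E → X} {p q : F → B} {S : Set (E ⊕ V × F)}

/-- The ends of the edges of a linked graph: of the edges of the old graph, and of the edges of
the copies attached. -/
noncomputable def linkEnd (φ : V → X) (r : B) (a : E → X) (p : F → B) :
    E ⊕ V × F → LinkVertex X V r :=
  Sum.elim (fun e => Sum.inl (a e)) fun y => linkPoint φ r y.1 (p y.2)

theorem injective_sym2_linkEnd (ha : Function.Injective fun e => s(a e, b e))
    (hp : Function.Injective fun y => s(p y, q y)) (hne : ∀ y, p y ≠ q y) :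
    Function.Injective fun z => s(linkEnd φ r a p z, linkEnd φ r b q z) := by
  rintro (e | ⟨v, y⟩) (e' | ⟨v', y'⟩) h
  · rw [ha (Sym2.map.injective Sum.inl_injective h)]
  · exact (sym2_inl_ne_sym2_linkPoint (hne y') _ _ h).elim
  · exact (sym2_inl_ne_sym2_linkPoint (hne y) _ _ h.symm).elim
  · obtain rfl : v = v' := eq_of_sym2_linkPoint_eq (hne y) h
    obtain rfl : y = y' := hp (Sym2.map.injective (linkPoint_injective φ r v) h)
    rfl

theorem isEdgeListing_graphLink {G : SimpleGraph X} {K : SimpleGraph B} (hG : IsEdgeListing G a b)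
    (hK : IsEdgeListing K p q) :
    IsEdgeListing (graphLink G φ K r) (linkEnd φ r a p) (linkEnd φ r b q) := by
  refine isEdgeListing_of_eq_edgeGraph_univ ?_
    (injective_sym2_linkEnd hG.injective hK.injective hK.ne) ?_
  · rw [graphLink, edgeGraph, ← hG.range_eq, ← hK.range_eq]
    congr 1
    ext s
    simp only [Set.mem_union, Set.mem_image, Set.mem_range, Set.mem_iUnion, exists_exists_eq_and,
      Set.mem_univ, true_and, Sum.exists, Prod.exists]
    rfl
  · rintro (e | ⟨v, y⟩) h
    · exact hG.ne e (Sum.inl_injective h)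
    · exact hK.ne y (linkPoint_injective φ r v h)

/-- Collapse each copy to the old vertex to which it is attached. -/
theorem connected_old_of_connected_link [Nonempty X]
    (h : (edgeGraph (linkEnd φ r a p) (linkEnd φ r b q) S).Connected) :
    (edgeGraph a b (Sum.inl ⁻¹' S)).Connected := by
  let collapse : LinkVertex X V r → X := Sum.elim id fun y => φ y.1
  have collapse_linkPoint (v : V) (x : B) : collapse (linkPoint φ r v x) = φ v := by
    unfold linkPoint
    split_ifs <;> rfl
  refine ⟨fun u w => reachable_map_of_edgeGraph collapse ?_
    (h.preconnected (Sum.inl u) (Sum.inl w))⟩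
  rintro (e | ⟨v, y⟩) he
  · exact reachable_edgeGraph (S := Sum.inl ⁻¹' S) he
  · simp only [linkEnd, Sum.elim_inr, collapse_linkPoint]
    rfl

open Classical in
/-- Collapse everything outside the copy at `v` to its root. -/
theorem connected_copy_of_connected_link (v : V)
    (h : (edgeGraph (linkEnd φ r a p) (linkEnd φ r b q) S).Connected) :
    (edgeGraph p q {y | Sum.inr (v, y) ∈ S}).Connected := by
  let collapse : LinkVertex X V r → B :=
    Sum.elim (fun _ => r) fun y => if y.1 = v then y.2 else r
  have collapse_linkPoint (w : V) (x : B) :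
      collapse (linkPoint φ r w x) = if w = v then x else r := by
    unfold linkPoint
    split_ifs <;> simp_all [collapse]
  have : Nonempty B := ⟨r⟩
  refine ⟨fun x y => ?_⟩
  have hxy := reachable_map_of_edgeGraph (H := edgeGraph p q {y | Sum.inr (v, y) ∈ S}) collapse ?_
    (h.preconnected (linkPoint φ r v x) (linkPoint φ r v y))
  · simpa only [collapse_linkPoint, if_true] using hxy
  rintro (e | ⟨w, y⟩) he
  · rfl
  · simp only [linkEnd, Sum.elim_inr, collapse_linkPoint]
    split_ifs with hw
    · subst hw
      exact reachable_edgeGraph (S := {y | Sum.inr (w, y) ∈ S}) he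
    · rfl

theorem connected_link_of_connected (hold : (edgeGraph a b (Sum.inl ⁻¹' S)).Connected)
    (hcopy : ∀ v, (edgeGraph p q {y | Sum.inr (v, y) ∈ S}).Connected) :
    (edgeGraph (linkEnd φ r a p) (linkEnd φ r b q) S).Connected := by
  let H := edgeGraph (linkEnd φ r a p) (linkEnd φ r b q) S
  have hedge (z) (hz : z ∈ S) : H.Reachable (linkEnd φ r a p z) (linkEnd φ r b q z) :=
    reachable_edgeGraph hz
  have hinl (u w : X) : H.Reachable (Sum.inl u) (Sum.inl w) :=
    reachable_map_of_edgeGraph Sum.inl (fun e he => hedge (Sum.inl e) he) (hold.preconnected u w)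
  have hlinkPoint (v : V) (x : B) : H.Reachable (Sum.inl (φ v)) (linkPoint φ r v x) := by
    rw [← linkPoint_root φ r v]
    exact reachable_map_of_edgeGraph (linkPoint φ r v) (fun y hy => hedge (Sum.inr (v, y)) hy)
      ((hcopy v).preconnected r x)
  obtain ⟨u⟩ := hold.nonempty
  refine (SimpleGraph.connected_iff_exists_forall_reachable _).2 ⟨Sum.inl u, ?_⟩
  rintro (w | ⟨v, x, hx⟩)
  · exact hinl u w
  · rw [← linkPoint_of_ne φ r v hx]
    exact (hinl u (φ v)).trans (hlinkPoint v x)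

theorem ncard_eq_ncard_preimage_inl_add_sum [Finite E] [Fintype V] [Finite F]
    (S : Set (E ⊕ V × F)) :
    S.ncard = (Sum.inl ⁻¹' S).ncard + ∑ v, {y | Sum.inr (v, y) ∈ S}.ncard := by
  let split : S ≃ ↥(Sum.inl ⁻¹' S : Set E) ⊕ (v : V) × ↥{y | Sum.inr (v, y) ∈ S} :=
    { toFun
        | ⟨Sum.inl e, h⟩ => Sum.inl ⟨e, h⟩
        | ⟨Sum.inr (v, y), h⟩ => Sum.inr ⟨v, y, h⟩
      invFun
        | Sum.inl ⟨e, h⟩ => ⟨Sum.inl e, h⟩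
        | Sum.inr ⟨v, y, h⟩ => ⟨Sum.inr (v, y), h⟩
      left_inv := by rintro ⟨e | ⟨v, y⟩, h⟩ <;> rfl
      right_inv := by rintro (⟨e, h⟩ | ⟨v, y, h⟩) <;> rfl }
  have hcard := Nat.card_congr split
  rwa [Nat.card_sum, Nat.card_sigma, Nat.card_coe_set_eq, Nat.card_coe_set_eq] at hcard

theorem card_linkVertex [Finite X] [Finite V] {k : ℕ} (hB : Nat.card B = k + 1) :
    Nat.card (LinkVertex X V r) = Nat.card X + Nat.card V * k := by
  have : Finite B := Nat.finite_of_card_ne_zero (by omega)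
  have hcompl := Set.ncard_add_ncard_compl {r}
  rw [Set.ncard_singleton, hB] at hcompl
  have hne : Nat.card {x // x ≠ r} = k :=
    (Nat.card_coe_set_eq {r}ᶜ).trans (Nat.add_left_cancel (hcompl.trans (Nat.add_comm k 1)))
  rw [Nat.card_sum, Nat.card_prod, hne]

/-- The edge counts of connected pieces are bounded below, and the total forces equality. -/
theorem isSpanningTreeSet_linkEnd_iff [Finite X] [Nonempty X] [Finite V] [Finite B] [Finite E]
    [Finite F] : IsSpanningTreeSet (linkEnd φ r a p) (linkEnd φ r b q) S ↔
      IsSpanningTreeSet a b (Sum.inl ⁻¹' S) ∧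
        ∀ v, IsSpanningTreeSet p q {y | Sum.inr (v, y) ∈ S} := by
  have := Fintype.ofFinite V
  have : Nonempty B := ⟨r⟩
  have hconn : (edgeGraph (linkEnd φ r a p) (linkEnd φ r b q) S).Connected ↔
      (edgeGraph a b (Sum.inl ⁻¹' S)).Connected ∧
        ∀ v, (edgeGraph p q {y | Sum.inr (v, y) ∈ S}).Connected :=
    ⟨fun h => ⟨connected_old_of_connected_link h, fun v => connected_copy_of_connected_link v h⟩,
      fun h => connected_link_of_connected h.1 h.2⟩
  simp only [IsSpanningTreeSet]
  rw [hconn, forall_and, and_and_and_comm]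
  refine and_congr_right fun ⟨hold, hcopy⟩ => ?_
  obtain ⟨k, hk⟩ : ∃ k, Nat.card B = k + 1 := Nat.exists_eq_succ_of_ne_zero Nat.card_pos.ne'
  have hold_le := card_le_of_connected_edgeGraph hold
  have hcopy_le (v : V) : k ≤ {y | Sum.inr (v, y) ∈ S}.ncard := by
    have := card_le_of_connected_edgeGraph (hcopy v)
    omega
  have hsum : ∑ _v : V, k = Nat.card V * k := by
    rw [Finset.sum_const, Finset.card_univ, smul_eq_mul, Nat.card_eq_fintype_card]
  have hsum_le := Finset.sum_le_sum fun v (_ : v ∈ Finset.univ) => hcopy_le v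
  have hsum_eq := Finset.sum_eq_sum_iff_of_le fun v (_ : v ∈ Finset.univ) => hcopy_le v
  simp only [Finset.mem_univ, true_imp_iff, eq_comm (a := k)] at hsum_eq
  simp only [hk, Nat.add_right_cancel_iff, ← hsum_eq]
  rw [ncard_eq_ncard_preimage_inl_add_sum, card_linkVertex hk, ← hsum]
  omega

theorem treeSetCount_linkEnd [Finite X] [Nonempty X] [Finite V] [Finite B] [Finite E] [Finite F]
    (φ : V → X) (r : B) (a b : E → X) (p q : F → B) :
    treeSetCount (linkEnd φ r a p) (linkEnd φ r b q) =
      treeSetCount a b * treeSetCount p q ^ Nat.card V := by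
  unfold treeSetCount
  rw [← Nat.card_fun, ← Nat.card_prod]
  refine Nat.card_congr
    { toFun := fun S =>
        have h := isSpanningTreeSet_linkEnd_iff.1 S.2
        (⟨Sum.inl ⁻¹' S.1, h.1⟩, fun v => ⟨{y | Sum.inr (v, y) ∈ S.1}, h.2 v⟩)
      invFun := fun T =>
        ⟨{z | Sum.elim (fun e => e ∈ T.1.1) (fun y : V × F => y.2 ∈ (T.2 y.1).1) z},
          isSpanningTreeSet_linkEnd_iff.2 ⟨T.1.2, fun v => (T.2 v).2⟩⟩
      left_inv := ?_
      right_inv := fun _ => rfl }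
  rintro ⟨S, hS⟩
  refine Subtype.ext (Set.ext ?_)
  rintro (e | ⟨v, y⟩) <;> rfl

theorem spanningTreeCount_graphLink [Finite X] [Nonempty X] [Finite V] [Finite B]
    (G : SimpleGraph X) (φ : V → X) (K : SimpleGraph B) (r : B) :
    spanningTreeCount (graphLink G φ K r) =
      spanningTreeCount G * spanningTreeCount K ^ Nat.card V := by
  have hG := isEdgeListing_edgeStart_edgeStop G
  have hK := isEdgeListing_edgeStart_edgeStop K
  rw [spanningTreeCount_eq_treeSetCount hG, spanningTreeCount_eq_treeSetCount hK,
    spanningTreeCount_eq_treeSetCount (isEdgeListing_graphLink hG hK), treeSetCount_linkEnd]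

theorem card_edgeSet_graphLink [Finite X] [Finite V] [Finite B]
    (G : SimpleGraph X) (φ : V → X) (K : SimpleGraph B) (r : B) :
    Nat.card (graphLink G φ K r).edgeSet =
      Nat.card G.edgeSet + Nat.card V * Nat.card K.edgeSet := by
  rw [(isEdgeListing_graphLink (isEdgeListing_edgeStart_edgeStop G)
    (isEdgeListing_edgeStart_edgeStop K)).card_edgeSet, Nat.card_sum, Nat.card_prod]

end Linking

theorem injective_wheelEdge (k : ℕ) : Function.Injective fun x : Fin (k + 3) ⊕ Fin (k + 3) =>
    s(Sum.elim (fun _ => none) some x, Sum.elim some (fun i => some (i + 1)) x) := by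
  rintro (i | i) (j | j) h <;>
    simp only [Sum.elim_inl, Sum.elim_inr, Sym2.eq_iff, Option.some_inj, reduceCtorEq,
      true_and, and_false, false_and, or_false] at h
  · rw [h]
  · rcases h with ⟨rfl, -⟩ | ⟨rfl, h⟩
    · rfl
    · exact (fin_add_one_ne_sub_one (j + 1) (h.trans (add_sub_cancel_right j 1).symm)).elim

theorem isEdgeListing_wheelGraph (k : ℕ) :
    IsEdgeListing (wheelGraph (k + 3)) (Sum.elim (fun _ => none) some)
      (Sum.elim some fun i => some (i + 1)) := by
  refine isEdgeListing_of_eq_edgeGraph_univ ?_ (injective_wheelEdge k) ?_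
  · ext u v
    rw [edgeGraph, SimpleGraph.fromEdgeSet_adj]
    rcases u with _ | i <;> rcases v with _ | j
    · simp
    · simp [wheelGraph]
    · simp [wheelGraph]
    · have hne (i : Fin (k + 3)) : i ≠ i + 1 := by simp
      rw [wheelGraph_adj_some_some]
      simp only [Set.image_univ, Set.mem_range, Sum.exists, Sum.elim_inl, Sum.elim_inr, Sym2.eq_iff,
        Option.some_inj, reduceCtorEq, false_and, or_false, exists_false, false_or, ne_eq]
      grind
  · rintro (i | i) <;> simp

theorem card_edgeSet_wheelGraph {n : ℕ} (hn : 3 ≤ n) :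
    Nat.card (wheelGraph n).edgeSet = 2 * n := by
  obtain ⟨k, rfl⟩ := Nat.exists_eq_add_of_le' hn
  rw [(isEdgeListing_wheelGraph k).card_edgeSet, Nat.card_sum, Nat.card_fin, two_mul]

theorem finite_wheelFractal (m n : ℕ) (r : Option (Fin n)) (i : ℕ) :
    Finite (wheelFractal m n r i).Vertex := by
  induction i with
  | zero => exact inferInstanceAs (Finite (Option (Fin n)))
  | succ i ih =>
    exact inferInstanceAs (Finite (LinkVertex
      (EdgePathVertex (wheelFractal m n r i).graph m) (wheelFractal m n r i).Vertex r))

theorem nonempty_wheelFractal (m n : ℕ) (r : Option (Fin n)) (i : ℕ) :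
    Nonempty (wheelFractal m n r i).Vertex := by
  induction i with
  | zero => exact ⟨r⟩
  | succ i ih => exact ih.map fun v => Sum.inl (Sum.inl v)

theorem wheelFractalOrder_one (m n : ℕ) (r : Option (Fin n)) :
    wheelFractalOrder m n r 1 = n + 1 :=
  Finite.card_option.trans (congrArg (· + 1) (Nat.card_fin n))

theorem wheelFractalOrder_add_two (m n : ℕ) (r : Option (Fin n)) (i : ℕ) :
    wheelFractalOrder m n r (i + 2) = wheelFractalOrder m n r (i + 1) +
      Nat.card (wheelFractal m n r i).graph.edgeSet * (m - 1) +
        wheelFractalOrder m n r (i + 1) * n := by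
  have := finite_wheelFractal m n r i
  refine (card_linkVertex (k := n) (by simp)).trans ?_
  rw [Nat.card_sum, Nat.card_prod, Nat.card_fin, wheelFractalOrder]

theorem card_edgeSet_wheelFractal_succ {n : ℕ} (m : ℕ) (hn : 3 ≤ n) (r : Option (Fin n)) (i : ℕ) :
    Nat.card (wheelFractal m n r (i + 1)).graph.edgeSet =
      Nat.card (wheelFractal m n r i).graph.edgeSet * m +
        wheelFractalOrder m n r (i + 1) * (2 * n) := by
  have := finite_wheelFractal m n r i
  refine (card_edgeSet_graphLink _ Sum.inl (wheelGraph n) r).trans ?_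
  rw [card_edgeSet_edgePathGraph, card_edgeSet_wheelGraph hn, wheelFractalOrder]

/-- The cyclomatic number of `wheelFractal m n r i` is `n ∑ j ≤ i, wheelFractalOrder m n r j`:
subdividing edges does not change it, and each attached wheel adds `n`. -/
theorem cyclomatic_wheelFractal {m n : ℕ} (hm : 1 ≤ m) (hn : 3 ≤ n) (r : Option (Fin n)) (i : ℕ) :
    n * ∑ j ∈ Finset.range (i + 1), wheelFractalOrder m n r j + wheelFractalOrder m n r (i + 1) =
      Nat.card (wheelFractal m n r i).graph.edgeSet + 1 := by
  induction i with
  | zero =>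
    have hedge : Nat.card (wheelFractal m n r 0).graph.edgeSet = 2 * n :=
      card_edgeSet_wheelGraph hn
    rw [hedge, zero_add, wheelFractalOrder_one, Finset.sum_range_one, wheelFractalOrder]
    ring
  | succ i ih =>
    obtain ⟨m, rfl⟩ := Nat.exists_eq_add_of_le' hm
    rw [Finset.sum_range_succ, card_edgeSet_wheelFractal_succ _ hn, wheelFractalOrder_add_two,
      Nat.add_sub_cancel]
    linarith

theorem spanningTreeCount_wheelFractal_succ {m n : ℕ} (hm : 1 ≤ m) (hn : 3 ≤ n)
    (r : Option (Fin n)) (i : ℕ) :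
    spanningTreeCount (wheelFractal m n r (i + 1)).graph =
      spanningTreeCount (wheelFractal m n r i).graph *
          m ^ (n * ∑ j ∈ Finset.range (i + 1), wheelFractalOrder m n r j) *
        spanningTreeCount (wheelGraph n) ^ wheelFractalOrder m n r (i + 1) := by
  have := finite_wheelFractal m n r i
  have := nonempty_wheelFractal m n r i
  refine (spanningTreeCount_graphLink _ Sum.inl (wheelGraph n) r).trans ?_
  rw [spanningTreeCount_edgePathGraph _ hm (cyclomatic_wheelFractal hm hn r i), wheelFractalOrder]

theorem sum_range_succ_sub_mul (a : ℕ → ℕ) (i : ℕ) :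
    ∑ j ∈ Finset.range (i + 2), (i + 1 - j) * a j =
      ∑ j ∈ Finset.range (i + 1), (i - j) * a j + ∑ j ∈ Finset.range (i + 1), a j := by
  rw [Finset.sum_range_succ, Nat.sub_self, zero_mul, add_zero, ← Finset.sum_add_distrib]
  refine Finset.sum_congr rfl fun j hj => ?_
  rw [Nat.succ_sub (Finset.mem_range_succ_iff.1 hj), Nat.succ_mul]

theorem spanningTreeCount_wheelFractal {m n : ℕ} (hm : 1 ≤ m) (hn : 3 ≤ n)
    (r : Option (Fin n)) (i : ℕ) :
    spanningTreeCount (wheelFractal m n r i).graph =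
      spanningTreeCount (wheelGraph n) ^ (∑ j ∈ Finset.range (i + 1), wheelFractalOrder m n r j) *
        m ^ (n * ∑ j ∈ Finset.range (i + 1), (i - j) * wheelFractalOrder m n r j) := by
  induction i with
  | zero => simp [wheelFractal, wheelFractalOrder]
  | succ i ih =>
    rw [spanningTreeCount_wheelFractal_succ hm hn, ih, sum_range_succ_sub_mul,
      Finset.sum_range_succ _ (i + 1)]
    ring

theorem sub_one_mul_card_edgeSet_wheelFractal {m n : ℕ} (hm : 1 ≤ m) (hn : 3 ≤ n)
    (r : Option (Fin n)) (i : ℕ) :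
    ((m : ℤ) - 1) * Nat.card (wheelFractal m n r i).graph.edgeSet =
      m * wheelFractalOrder m n r (i + 1) +
        ((m : ℤ) * n - m - 2 * n) * wheelFractalOrder m n r i := by
  cases i with
  | zero =>
    have hedge : Nat.card (wheelFractal m n r 0).graph.edgeSet = 2 * n :=
      card_edgeSet_wheelGraph hn
    rw [hedge, zero_add, wheelFractalOrder_one, wheelFractalOrder]
    push_cast
    ring
  | succ i =>
    have horder := wheelFractalOrder_add_two m n r i
    rw [card_edgeSet_wheelFractal_succ m hn]
    zify [hm] at horder ⊢
    linear_combination (-(m : ℤ)) * horder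

theorem wheelFractalOrder_recurrence {m n : ℕ} (hm : 1 ≤ m) (hn : 3 ≤ n) (r : Option (Fin n))
    (i : ℕ) :
    (wheelFractalOrder m n r (i + 2) : ℤ) =
      ((n : ℤ) + m + 1) * wheelFractalOrder m n r (i + 1) +
        ((m : ℤ) * n - m - 2 * n) * wheelFractalOrder m n r i := by
  have horder := wheelFractalOrder_add_two m n r i
  zify [hm] at horder
  linear_combination horder + sub_one_mul_card_edgeSet_wheelFractal hm hn r i

theorem mainTheorem2 (m n : ℕ) (hm : 1 ≤ m) (hn : 3 ≤ n) (r : Option (Fin n)) :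
    (∀ i : ℕ,
      (spanningTreeCount (wheelFractal m n r i).graph : ℤ) =
        ((lucas (2 * n) : ℤ) - 2) ^ (∑ j ∈ Finset.range (i + 1), wheelFractalOrder m n r j) *
          (m : ℤ) ^ (n * ∑ j ∈ Finset.range (i + 1), (i - j) * wheelFractalOrder m n r j)) ∧
    wheelFractalOrder m n r 0 = 1 ∧
    wheelFractalOrder m n r 1 = n + 1 ∧
    (∀ i : ℕ, 2 ≤ i →
      (wheelFractalOrder m n r i : ℤ) =
        ((n : ℤ) + m + 1) * wheelFractalOrder m n r (i - 1) +
          ((m : ℤ) * n - m - 2 * n) * wheelFractalOrder m n r (i - 2)) := by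
  refine ⟨fun i => ?_, rfl, wheelFractalOrder_one m n r, fun i hi => ?_⟩
  · have hwheel : (lucas (2 * n) : ℤ) - 2 = spanningTreeCount (wheelGraph n) :=
      sub_eq_of_eq_add (mod_cast (spanningTreeCount_wheelGraph hn).symm)
    rw [hwheel]
    exact_mod_cast spanningTreeCount_wheelFractal hm hn r i
  · obtain ⟨i, rfl⟩ := Nat.exists_eq_add_of_le' hi
    exact wheelFractalOrder_recurrence hm hn r i
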